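/- Let $N\ge 2$, $R>0$, let $B_R\subset\mathbb R^N$ be the open ball of radius $R$ centred at the origin, and let $C_N$ be the Lebesgue measure of the unit ball of $\mathbb R^N$. Let $f\in L^1(B_R)$ be non-negative, radially symmetric and radially decreasing (i.e. $f(x)=g(|x|)$ for a.e. $x \in B_R$ with $g$ non-increasing on $(0,R)$). Let $$f^*(s)=\inf\{\tau\ge 0:\ |\{x\in B_R: |f(x)|>\tau\}|\le s\}\ (s\ge 0),\qquad f^{**}(t)=\frac1t\int_0^t f^*(s)\,ds\ (t>0),$$ and, for $\alpha>0$, $H_\alpha(\xi)=(|\xi|-1)_+^{\alpha}\,\frac{\xi}{|\xi|}$ for $\xi\in\mathbb R^N\setminus\{0\}$, $H_\alpha(0)=0$. Let $p>1$ and let $u_p\in W^{1,p}_0(B_R)$ be any weak solution of $-\operatorname{div}\big(H_{p-1}(\nabla u_p)\big)=f$ in $B_R$, $u_p=0$ on $\partial B_R$, i.e. $\int_{B_R}\langle H_{p-1}(\nabla u_p),\nabla\varphi\rangle\,dx=\int_{B_R}f\varphi\,dx$ for every $\varphi\in C_0^\infty(B_R)$. Then $$H_1(\nabla u_p)(x)=-\left(\frac{|x|}{N}f^{**}(C_N|x|^N)\right)^{\frac1{p-1}}\frac{x}{|x|}\qquad\text{for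 a.e. }x\in B_R,$$ and therefore $$\nabla u_p(x)=-\left[1+\left(\frac{|x|}{N}f^{**}(C_N|x|^N)\right)^{\frac1{p-1}}\right]\frac{x}{|x|}\qquad\text{for a.e. }x\in B_R\text{ with }|\nabla u_p(x)|>1.$$ -/

import Mathlib

open MeasureTheory Set Filter Topology
open scoped ENNReal InnerProductSpace Gradient Distributions

namespace WidelyDegenerate

/-- Euclidean space of dimension `N`. -/
abbrev Euc (N : ℕ) : Type := EuclideanSpace ℝ (Fin N)

/-- The open ball of radius `R` centered at the origin, as an open set. -/
def openBall (N : ℕ) (R : ℝ) : TopologicalSpace.Opens (Euc N) :=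
  ⟨Metric.ball 0 R, Metric.isOpen_ball⟩

/-- The Lebesgue measure on the ball of radius `R`. -/
noncomputable def ballMeasure (N : ℕ) (R : ℝ) : Measure (Euc N) :=
  volume.restrict (Metric.ball 0 R)

/-- The Lebesgue measure of the unit ball. -/
noncomputable def unitBallVolume (N : ℕ) : ℝ :=
  (volume (Metric.ball (0 : Euc N) 1)).toReal

/-! ### Rearrangements -/

section Rearrangement

variable {α : Type*} [MeasurableSpace α]

/-- The distribution function `τ ↦ μ {|f| > τ}`. -/
noncomputable def distribFun (μ : Measure α) (f : α → ℝ) (τ : ℝ≥0∞) : ℝ≥0∞ :=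
  μ {x | τ < ‖f x‖ₑ}

/-- The decreasing rearrangement `f* (s) = inf {τ ≥ 0 : μ {|f| > τ} ≤ s}`; it is extended-valued
because `f* (0)` is the essential supremum of `|f|`. -/
noncomputable def decRearr (μ : Measure α) (f : α → ℝ) (s : ℝ) : ℝ≥0∞ :=
  sInf {τ : ℝ≥0∞ | distribFun μ f τ ≤ ENNReal.ofReal s}

/-- The maximal function `f** (t) = t⁻¹ ∫₀ᵗ f* (s) ds` of the decreasing rearrangement. It is
finite for `t > 0` when `f` is integrable. -/
noncomputable def maxRearr (μ : Measure α) (f : α → ℝ) (t : ℝ) : ℝ≥0∞ :=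
  (∫⁻ s in Ioc 0 t, decRearr μ f s) / ENNReal.ofReal t

end Rearrangement

/-- `f` agrees almost everywhere on the ball of radius `R` with a radially symmetric,
(weakly) decreasing function of the distance to the origin. -/
def RadiallyDecreasing {N : ℕ} (R : ℝ) (f : Euc N → ℝ) : Prop :=
  ∃ g : ℝ → ℝ, AntitoneOn g (Ioo 0 R) ∧ ∀ᵐ x ∂(ballMeasure N R), f x = g ‖x‖

/-! ### Sobolev spaces and weak solutions -/

/-- `Du` is the weak gradient of `u` on the open set `Ω`. -/
structure IsWeakGradient {N : ℕ} (Ω : TopologicalSpace.Opens (Euc N))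
    (u : Euc N → ℝ) (Du : Euc N → Euc N) : Prop where
  locInt : LocallyIntegrableOn u Ω volume
  locInt_grad : LocallyIntegrableOn Du Ω volume
  integral_eq : ∀ φ : 𝓓(Ω, ℝ),
    ∫ x in (Ω : Set (Euc N)), u x • ∇ (φ : Euc N → ℝ) x =
      -∫ x in (Ω : Set (Euc N)), φ x • Du x

/-- `u` belongs to `W^{1,p}(Ω)`, with weak gradient `Du`. -/
structure MemW1p {N : ℕ} (Ω : TopologicalSpace.Opens (Euc N)) (p : ℝ≥0∞)
    (u : Euc N → ℝ) (Du : Euc N → Euc N) : Prop where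
  weakGrad : IsWeakGradient Ω u Du
  memLp : MemLp u p (volume.restrict Ω)
  memLp_grad : MemLp Du p (volume.restrict Ω)

/-- `u` belongs to `W₀^{1,p}(Ω)`, the closure of the test functions in `W^{1,p}(Ω)`, with weak
gradient `Du`. -/
structure MemW01p {N : ℕ} (Ω : TopologicalSpace.Opens (Euc N)) (p : ℝ≥0∞)
    (u : Euc N → ℝ) (Du : Euc N → Euc N) : Prop where
  memW1p : MemW1p Ω p u Du
  approx : ∃ φ : ℕ → 𝓓(Ω, ℝ),
    Tendsto (fun n => eLpNorm (fun x => φ n x - u x) p (volume.restrict Ω)) atTop (𝓝 0) ∧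
    Tendsto (fun n => eLpNorm (fun x => ∇ (φ n : Euc N → ℝ) x - Du x) p (volume.restrict Ω))
      atTop (𝓝 0)

/-- `H_α(ξ) = (|ξ| - 1)₊^α ξ / |ξ|`, and `H_α(0) = 0`. -/
noncomputable def H {N : ℕ} (α : ℝ) (ξ : Euc N) : Euc N :=
  (max (‖ξ‖ - 1) 0) ^ α • (‖ξ‖⁻¹ • ξ)

/-- `u`, with weak gradient `Du`, is a weak solution in `W₀^{1,p}` of the Dirichlet problem
`-div H_{p-1}(∇u) = f` in the ball of radius `R`, `u = 0` on its boundary. -/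
structure IsWeakSolution {N : ℕ} (p R : ℝ) (f : Euc N → ℝ)
    (u : Euc N → ℝ) (Du : Euc N → Euc N) : Prop where
  memW01p : MemW01p (openBall N R) (ENNReal.ofReal p) u Du
  integral_eq : ∀ φ : 𝓓(openBall N R, ℝ),
    ∫ x in Metric.ball 0 R, ⟪H (p - 1) (Du x), ∇ (φ : Euc N → ℝ) x⟫_ℝ =
      ∫ x in Metric.ball 0 R, f x * φ x

/-- The radial profile `((|x| / N) f** (C_N |x|^N))^{1/(p-1)}`, where the rearrangement of `f` is
taken on the ball of radius `R`. -/
noncomputable def profile {N : ℕ} (p R : ℝ) (f : Euc N → ℝ) (x : Euc N) : ℝ :=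
  (‖x‖ / N * (maxRearr (ballMeasure N R) f (unitBallVolume N * ‖x‖ ^ N)).toReal) ^ (1 / (p - 1))

end WidelyDegenerate

/-! The field `V = -a x/|x|` with `a(x) = |x|^{1-N} ∫₀^{|x|} ρ^{N-1} f(ρ) dρ` has divergence `-f`,
and `a` equals `(|x|/N) f**(C_N |x|^N)` because for radially decreasing `f` the integral of `f*`
over `(0, |B_r|)` is that of `f` over `B_r`. Put `W = -(1 + a^{1/(p-1)}) x/|x|`, so that `H_{p-1}(W)
= V`. The theorem follows from `∫ ⟨H_{p-1}(∇u) - H_{p-1}(W), ∇u - W⟩ = 0`: the integrand is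
non-negative, and where it vanishes `H_1(∇u) = H_1(W)`.

Call the first factor `D`; it is orthogonal to gradients of test functions. Since `f` is only
integrable, `a` is a priori only in `L¹`, while the pairing with `∇u` needs `D ∈ L^q`, `q =
p/(p-1)`. Radial test functions show that the conditional expectation of `⟨D, x/|x|⟩` given `|x|²`
is zero. So `a` is minus the conditional expectation of `⟨H_{p-1}(∇u), x/|x|⟩`, and `L^q`
contractivity puts `a` in `L^q`. Density then gives `∫ ⟨D, ∇u⟩ = 0`. The same vanishing gives `∫ ⟨D,
W⟩ = 0`, as `W` is a radial factor times `x/|x|`; `W` need not be exhibited as a Sobolev gradient.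

The main lemmas are `lintegral_decRearr_of_radial`, `integral_segmentMean_mul_inner_gradient`,
`condExp_comap_eq_zero` and `H_one_eq_of_radial_flux`. -/

namespace WidelyDegenerate

/-! ### Layer cake formula and decreasing rearrangements -/

section Rearrangement

variable {α : Type*} [MeasurableSpace α]

/-- Layer cake formula for extended-valued functions. -/
lemma lintegral_eq_lintegral_measure_lt (μ : Measure α) [SFinite μ] {F : α → ℝ≥0∞}
    (hF : Measurable F) :
    ∫⁻ x, F x ∂μ = ∫⁻ τ in Ioi (0 : ℝ), μ {x | ENNReal.ofReal τ < F x} := by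
  have hS : MeasurableSet {q : α × ℝ | ENNReal.ofReal q.2 < F q.1} :=
    measurableSet_lt (by fun_prop) (by fun_prop)
  have h1 : ∀ x, F x = ∫⁻ τ in Ioi (0 : ℝ),
      {q : α × ℝ | ENNReal.ofReal q.2 < F q.1}.indicator (1 : α × ℝ → ℝ≥0∞) (x, τ) := by
    intro x
    have : (fun τ : ℝ => {q : α × ℝ | ENNReal.ofReal q.2 < F q.1}.indicator
        (1 : α × ℝ → ℝ≥0∞) (x, τ)) = {τ : ℝ | ENNReal.ofReal τ < F x}.indicator 1 := by
      ext τ; simp [indicator]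
    rw [this, lintegral_indicator_one (measurableSet_lt (by fun_prop) (by fun_prop)),
      Measure.restrict_apply (measurableSet_lt (by fun_prop) (by fun_prop))]
    rcases eq_or_ne (F x) ∞ with h | h
    · simp [h]
    · have : {τ : ℝ | ENNReal.ofReal τ < F x} ∩ Ioi 0 = Ioo 0 (F x).toReal := by
        ext τ
        simp only [mem_inter_iff, mem_ofPred_eq, mem_Ioi, mem_Ioo]
        constructor
        · rintro ⟨h1, h2⟩
          exact ⟨h2, (ENNReal.ofReal_lt_iff_lt_toReal h2.le h).1 h1⟩
        · rintro ⟨h1, h2⟩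
          exact ⟨(ENNReal.ofReal_lt_iff_lt_toReal h1.le h).2 h2, h1⟩
      rw [this, Real.volume_Ioo, sub_zero, ENNReal.ofReal_toReal h]
  calc ∫⁻ x, F x ∂μ = ∫⁻ x, (∫⁻ τ in Ioi (0 : ℝ),
      {q : α × ℝ | ENNReal.ofReal q.2 < F q.1}.indicator (1 : α × ℝ → ℝ≥0∞) (x, τ)) ∂μ :=
        lintegral_congr h1
    _ = ∫⁻ τ in Ioi (0 : ℝ), ∫⁻ x,
      {q : α × ℝ | ENNReal.ofReal q.2 < F q.1}.indicator (1 : α × ℝ → ℝ≥0∞) (x, τ) ∂μ := by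
        rw [lintegral_lintegral_swap]
        exact (measurable_one.indicator hS).aemeasurable
    _ = _ := by
        refine lintegral_congr fun τ => ?_
        have : (fun x : α => {q : α × ℝ | ENNReal.ofReal q.2 < F q.1}.indicator
          (1 : α × ℝ → ℝ≥0∞) (x, τ)) = {x | ENNReal.ofReal τ < F x}.indicator 1 := by
          ext x; simp [indicator]
        rw [this, lintegral_indicator_one (measurableSet_lt (by fun_prop) (by fun_prop))]

lemma distribFun_antitone (μ : Measure α) (f : α → ℝ) : Antitone (distribFun μ f) :=
  fun _ _ h => measure_mono fun _ hx => lt_of_le_of_lt h hx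

lemma decRearr_antitone (μ : Measure α) (f : α → ℝ) : Antitone (decRearr μ f) :=
  fun _ _ h => sInf_le_sInf fun _ hτ => le_trans hτ (ENNReal.ofReal_le_ofReal h)

/-- The distribution function is right-continuous. -/
lemma distribFun_le_of_forall_gt {μ : Measure α} {f : α → ℝ} {τ : ℝ≥0∞} {c : ℝ≥0∞}
    (h : ∀ τ' > τ, distribFun μ f τ' ≤ c) : distribFun μ f τ ≤ c := by
  rcases eq_or_ne τ ∞ with rfl | hτ
  · simp [distribFun]
  -- Along levels decreasing to `τ` the superlevel sets increase to that of `τ`, so continuity from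
  -- below applies.
  · obtain ⟨v, hv, hv1, hv2⟩ := exists_seq_strictAnti_tendsto' (lt_top_iff_ne_top.2 hτ)
    have : {x | τ < ‖f x‖ₑ} = ⋃ n, {x | v n < ‖f x‖ₑ} := by
      ext x
      simp only [mem_ofPred_eq, mem_iUnion]
      constructor
      · intro hx
        exact ((tendsto_order.1 hv2).2 _ hx).exists
      · rintro ⟨n, hn⟩
        exact (hv1 n).1.trans hn
    unfold distribFun
    rw [this, Monotone.measure_iUnion]
    · exact iSup_le fun n => h _ (hv1 n).1
    · intro m n hmn x hx
      exact lt_of_le_of_lt (hv.antitone hmn) hx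

/-- Right-continuity of the distribution function means that the infimum defining `f*` is attained;
hence an exact equivalence, which turns superlevel sets of `f*` into intervals. -/
lemma lt_decRearr_iff {μ : Measure α} {f : α → ℝ} {τ : ℝ≥0∞} {s : ℝ} :
    τ < decRearr μ f s ↔ ENNReal.ofReal s < distribFun μ f τ := by
  constructor
  · intro h
    by_contra! h'
    have h2 : decRearr μ f s ≤ τ := sInf_le h'
    exact absurd h2 (not_le.2 h)
  · intro h
    by_contra! h'
    refine absurd (distribFun_le_of_forall_gt fun τ' hτ' => ?_) (not_le.2 h)
    obtain ⟨σ, hσ, hσ'⟩ := sInf_lt_iff.1 (lt_of_le_of_lt h' hτ')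
    exact (distribFun_antitone μ f hσ'.le).trans hσ

/-- The integral of the decreasing rearrangement over `(0, μ B)` equals the integral of `|f|` over
`B`, if the superlevel sets of `f` are nested with `B`. -/
lemma lintegral_decRearr_eq (μ : Measure α) [SFinite μ] {f : α → ℝ} (hf : AEMeasurable f μ)
    {B : Set α} {t : ℝ} (hB : μ B = ENNReal.ofReal t)
    (hnest : ∀ τ : ℝ≥0∞, μ ({x | τ < ‖f x‖ₑ} ∩ B) = min (distribFun μ f τ) (μ B)) :
    ∫⁻ s in Ioc 0 t, decRearr μ f s = ∫⁻ x in B, ‖f x‖ₑ ∂μ := by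
  have h1 : ∫⁻ x in B, ‖f x‖ₑ ∂μ
      = ∫⁻ τ in Ioi (0 : ℝ), min (distribFun μ f (ENNReal.ofReal τ)) (μ B) := by
    have hf' := hf.mono_measure (Measure.restrict_le_self (s := B))
    have h0 : (fun x => ‖f x‖ₑ) =ᵐ[μ.restrict B] fun x => ‖hf'.mk f x‖ₑ :=
      hf'.ae_eq_mk.fun_comp fun y => ‖y‖ₑ
    rw [lintegral_congr_ae h0,
      lintegral_eq_lintegral_measure_lt _ (hf'.measurable_mk.enorm)]
    refine lintegral_congr fun τ => ?_
    rw [← hnest]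
    have hm : NullMeasurableSet {x | ENNReal.ofReal τ < ‖f x‖ₑ} (μ.restrict B) :=
      nullMeasurableSet_lt aemeasurable_const hf'.enorm
    rw [← Measure.restrict_apply₀ hm]
    refine measure_congr ?_
    filter_upwards [hf'.ae_eq_mk] with x hx
    apply propext
    change _ < _ ↔ _ < _
    rw [hx]
  rw [h1, lintegral_eq_lintegral_measure_lt _ (decRearr_antitone μ f).measurable]
  refine lintegral_congr fun τ => ?_
  simp only [lt_decRearr_iff]
  set d := distribFun μ f (ENNReal.ofReal τ)
  rw [hB, Measure.restrict_apply (measurableSet_lt (by fun_prop) (by fun_prop))]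
  rcases eq_or_ne d ∞ with h | h
  · simp [h]
  · rcases le_or_gt t 0 with ht | ht
    · simp [Ioc_eq_empty (not_lt.2 ht), ENNReal.ofReal_of_nonpos ht]
    have key : min d (ENNReal.ofReal t) = ENNReal.ofReal (min d.toReal t) := by
      rw [ENNReal.ofReal_min, ENNReal.ofReal_toReal h]
    rw [key]
    -- The superlevel set of `f*` is caught between an open and a half-open interval with the same
    -- endpoints.
    apply le_antisymm
    · have : {s | ENNReal.ofReal s < d} ∩ Ioc 0 t ⊆ Ioc 0 (min d.toReal t) := by
        rintro s ⟨hs, hs1, hs2⟩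
        exact ⟨hs1, le_min ((ENNReal.ofReal_lt_iff_lt_toReal hs1.le h).1 hs).le hs2⟩
      simpa using measure_mono (μ := volume) this
    · have : Ioo 0 (min d.toReal t) ⊆ {s | ENNReal.ofReal s < d} ∩ Ioc 0 t := by
        rintro s ⟨hs1, hs2⟩
        rw [lt_min_iff] at hs2
        exact ⟨(ENNReal.ofReal_lt_iff_lt_toReal hs1.le h).2 hs2.1, hs1, hs2.2.le⟩
      simpa using measure_mono (μ := volume) this

end Rearrangement

/-! ### Radially decreasing functions on balls -/

lemma ae_ballMeasure_mem {N : ℕ} (hN : 0 < N) (R : ℝ) :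
    ∀ᵐ x ∂(ballMeasure N R), 0 < ‖x‖ ∧ ‖x‖ < R := by
  have : Nonempty (Fin N) := ⟨⟨0, hN⟩⟩
  have h1 : ∀ᵐ x ∂(ballMeasure N R), x ≠ 0 :=
    ae_restrict_of_ae (by simp [ae_iff])
  filter_upwards [h1, ae_restrict_mem measurableSet_ball] with x hx hx'
  exact ⟨norm_pos_iff.2 hx, by simpa using hx'⟩

lemma volume_ball_eq {N : ℕ} (hN : 0 < N) {r : ℝ} (hr : 0 ≤ r) :
    volume (Metric.ball (0 : Euc N) r) = ENNReal.ofReal (unitBallVolume N * r ^ N) := by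
  have : Nonempty (Fin N) := ⟨⟨0, hN⟩⟩
  rw [Measure.addHaar_ball _ _ hr, unitBallVolume, ENNReal.ofReal_mul ENNReal.toReal_nonneg,
    ENNReal.ofReal_toReal measure_ball_lt_top.ne, mul_comm]
  simp

/-- For a radially decreasing function, `f*` integrates over `(0, |B_r|)` as `f` over `B_r`. -/
lemma lintegral_decRearr_of_radial {N : ℕ} (hN : 0 < N) {R r : ℝ} (hr : 0 ≤ r) (hrR : r ≤ R)
    {f : Euc N → ℝ} {g : ℝ → ℝ} (hf : AEMeasurable f (ballMeasure N R))
    (hg : AntitoneOn g (Ioo 0 R)) (hg0 : ∀ s, 0 ≤ g s)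
    (hfg : ∀ᵐ x ∂(ballMeasure N R), f x = g ‖x‖) :
    ∫⁻ s in Ioc 0 (unitBallVolume N * r ^ N), decRearr (ballMeasure N R) f s
      = ∫⁻ x in Metric.ball 0 r, ‖f x‖ₑ := by
  have hsub : Metric.ball (0 : Euc N) r ⊆ Metric.ball 0 R := Metric.ball_subset_ball hrR
  have hB : (ballMeasure N R) (Metric.ball 0 r) = ENNReal.ofReal (unitBallVolume N * r ^ N) := by
    rw [ballMeasure, Measure.restrict_apply measurableSet_ball, inter_eq_left.2 hsub,
      volume_ball_eq hN hr]
  have : SFinite (ballMeasure N R) := by unfold ballMeasure; infer_instance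
  rw [lintegral_decRearr_eq _ hf hB]
  · rw [ballMeasure, Measure.restrict_restrict measurableSet_ball, inter_eq_left.2 hsub]
  · intro τ
    apply le_antisymm
    · exact le_min (measure_mono inter_subset_left) (measure_mono inter_subset_right)
    -- If the level is exceeded somewhere outside `B_r`, monotonicity puts `B_r` inside the
    -- superlevel set; otherwise the superlevel set lies in `B_r`. Both hold up to null sets.
    · by_cases h : ∃ y : Euc N, r ≤ ‖y‖ ∧ ‖y‖ < R ∧ τ < ‖g ‖y‖‖ₑ
      · obtain ⟨y, hy1, hy2, hy3⟩ := h
        refine min_le_of_right_le (measure_mono_ae ?_)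
        filter_upwards [hfg, ae_ballMeasure_mem hN R] with x hx hx'
        intro hxr
        refine ⟨?_, hxr⟩
        have hxr' : ‖x‖ < r := mem_ball_zero_iff.1 hxr
        change τ < ‖f x‖ₑ
        rw [hx]
        refine hy3.trans_le ?_
        rw [Real.enorm_of_nonneg (hg0 _), Real.enorm_of_nonneg (hg0 _)]
        exact ENNReal.ofReal_le_ofReal (hg hx' ⟨by linarith, hy2⟩ (by linarith))
      · push Not at h
        refine min_le_of_left_le (measure_mono_ae ?_)
        filter_upwards [hfg, ae_ballMeasure_mem hN R] with x hx hx'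
        intro hxτ
        refine ⟨hxτ, ?_⟩
        by_contra hxr
        have hxr' : r ≤ ‖x‖ := by
          by_contra h'
          exact hxr (by simpa using h')
        have := h x hxr' hx'.2
        rw [← hx] at this
        exact absurd hxτ (not_lt.2 this)


/-! ### Segment means and an explicit field of divergence `-f` -/

/-- The average `∫₁^∞ s^{-N-1} f (x / s) ds` of `f` along the segment from the origin to `x`. -/
noncomputable def segmentMean {N : ℕ} (f : Euc N → ℝ) (x : Euc N) : ℝ :=
  ∫ s in Ioi (1 : ℝ), (s ^ (N + 1))⁻¹ * f (s⁻¹ • x)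

section Dilation

variable {N : ℕ} {R C : ℝ} {f h : Euc N → ℝ}

/-- For fixed `y`, `|h(sy)/s| ≤ C|y|` and only `s < R/|y|` contributes, so the `s`-integral is at
most `CR` uniformly in `y`. At `y = 0` the hypothesis gives `h 0 = 0`. -/
lemma integrable_prod_mul_comp_smul (hR : 0 ≤ R) (hC : 0 ≤ C) (hf : Integrable f)
    (hfm : Measurable f) (hm : Measurable h) (hb : ∀ x, |h x| ≤ C * ‖x‖)
    (h0 : ∀ x, R ≤ ‖x‖ → h x = 0) :
    Integrable (fun q : Euc N × ℝ => f q.1 * (h (q.2 • q.1) / q.2))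
      (volume.prod (volume.restrict (Ioi 1))) := by
  have hmeas : Measurable (fun q : Euc N × ℝ => f q.1 * (h (q.2 • q.1) / q.2)) := by fun_prop
  have hbound : ∀ y : Euc N, ∀ s ∈ Ioi (1 : ℝ), ‖f y * (h (s • y) / s)‖ ≤
      (Ioo 1 (R / ‖y‖)).indicator (fun _ => |f y| * (C * ‖y‖)) s := by
    intro y s hs
    have hs0 : 0 < s := zero_lt_one.trans hs
    rcases eq_or_ne y 0 with rfl | hy
    · have : h 0 = 0 := by simpa using hb 0
      simp [this]
    · have hy' := norm_pos_iff.2 hy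
      by_cases hsR : s < R / ‖y‖
      · rw [indicator_of_mem (show s ∈ Ioo 1 (R / ‖y‖) from ⟨hs, hsR⟩), norm_mul,
          Real.norm_eq_abs]
        gcongr
        rw [norm_div, Real.norm_eq_abs, Real.norm_eq_abs, abs_of_pos hs0, div_le_iff₀ hs0]
        refine (hb _).trans (le_of_eq ?_)
        rw [norm_smul, Real.norm_eq_abs, abs_of_pos hs0]
        ring
      · rw [h0 (s • y)]
        · simpa using indicator_nonneg (fun _ _ => by positivity) _
        · rw [norm_smul, Real.norm_eq_abs, abs_of_pos hs0]
          rw [not_lt, div_le_iff₀ hy'] at hsR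
          exact hsR
  have hint : ∀ y : Euc N, Integrable
      ((Ioo 1 (R / ‖y‖)).indicator (fun _ : ℝ => |f y| * (C * ‖y‖)))
      (volume.restrict (Ioi 1)) := fun y =>
    ((integrable_indicator_iff measurableSet_Ioo).2
      (integrableOn_const (by simp))).restrict
  rw [integrable_prod_iff hmeas.aestronglyMeasurable]
  refine ⟨Eventually.of_forall fun y => (hint y).mono' (by fun_prop) ?_, ?_⟩
  · filter_upwards [ae_restrict_mem measurableSet_Ioi] with s hs using hbound y s hs
  · refine Integrable.mono' (hf.norm.mul_const (C * R))
      (hmeas.norm.aestronglyMeasurable.integral_prod_right') ?_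
    refine Eventually.of_forall fun y => ?_
    rw [Real.norm_of_nonneg (integral_nonneg fun _ => norm_nonneg _)]
    calc ∫ s in Ioi 1, ‖f y * (h (s • y) / s)‖
        ≤ ∫ s in Ioi 1, (Ioo 1 (R / ‖y‖)).indicator (fun _ => |f y| * (C * ‖y‖)) s := by
          refine integral_mono_of_nonneg (Eventually.of_forall fun _ => norm_nonneg _) (hint y) ?_
          filter_upwards [ae_restrict_mem measurableSet_Ioi] with s hs using hbound y s hs
      _ = max (R / ‖y‖ - 1) 0 * (|f y| * (C * ‖y‖)) := by
          rw [setIntegral_indicator measurableSet_Ioo, setIntegral_const,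
            inter_eq_right.2 (fun s hs => hs.1), Real.volume_real_Ioo, smul_eq_mul]
      _ ≤ R / ‖y‖ * (|f y| * (C * ‖y‖)) := by
          gcongr
          exact max_le (by linarith) (by positivity)
      _ = ‖f y‖ * C * (‖y‖ * (R / ‖y‖)) := by rw [Real.norm_eq_abs]; ring
      _ ≤ ‖f y‖ * C * R := by
          gcongr
          rcases eq_or_ne ‖y‖ 0 with h | h
          · simp [h, hR]
          · rw [mul_div_cancel₀ _ h]
      _ = ‖f y‖ * (C * R) := by ring

lemma mul_inv_pow_smul_eq {s : ℝ} (hs : 0 < s) (y : Euc N) :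
    h (s • y) * ((s ^ (N + 1))⁻¹ * f (s⁻¹ • s • y)) = (s ^ N)⁻¹ * (f y * (h (s • y) / s)) := by
  rw [smul_smul, inv_mul_cancel₀ hs.ne', one_smul]
  field_simp
  ring

/-- The substitution `x = sy` for each fixed `s` has Jacobian `s^N`, which reduces this to
`integrable_prod_mul_comp_smul`. -/
lemma integrable_prod_mul_dilation (hR : 0 ≤ R) (hC : 0 ≤ C) (hf : Integrable f)
    (hfm : Measurable f) (hm : Measurable h) (hb : ∀ x, |h x| ≤ C * ‖x‖)
    (h0 : ∀ x, R ≤ ‖x‖ → h x = 0) :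
    Integrable (fun q : Euc N × ℝ => h q.1 * ((q.2 ^ (N + 1))⁻¹ * f (q.2⁻¹ • q.1)))
      (volume.prod (volume.restrict (Ioi 1))) := by
  have hmeas : Measurable
    (fun q : Euc N × ℝ => h q.1 * ((q.2 ^ (N + 1))⁻¹ * f (q.2⁻¹ • q.1))) := by fun_prop
  have key := integrable_prod_mul_comp_smul hR hC hf hfm hm hb h0
  rw [integrable_prod_iff' key.aestronglyMeasurable] at key
  rw [integrable_prod_iff' hmeas.aestronglyMeasurable]
  refine ⟨?_, key.2.congr ?_⟩
  · filter_upwards [key.1, ae_restrict_mem measurableSet_Ioi] with s hs hs1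
    have hs0 : 0 < s := zero_lt_one.trans hs1
    rw [← integrable_comp_smul_iff volume _ hs0.ne']
    simp only [mul_inv_pow_smul_eq hs0]
    exact hs.const_mul _
  · filter_upwards [ae_restrict_mem measurableSet_Ioi] with s hs1
    have hs0 : 0 < s := zero_lt_one.trans hs1
    have h1 := Measure.integral_comp_smul_of_nonneg (volume : Measure (Euc N))
      (fun x => ‖h x * ((s ^ (N + 1))⁻¹ * f (s⁻¹ • x))‖) s (hR := hs0.le)
    simp only [mul_inv_pow_smul_eq hs0, norm_mul ((s ^ N)⁻¹), integral_const_mul] at h1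
    rw [Real.norm_of_nonneg (by positivity), finrank_euclideanSpace_fin, smul_eq_mul] at h1
    exact mul_left_cancel₀ (by positivity) h1

lemma integrable_mul_segmentMean (hR : 0 ≤ R) (hC : 0 ≤ C) (hf : Integrable f)
    (hfm : Measurable f) (hm : Measurable h) (hb : ∀ x, |h x| ≤ C * ‖x‖)
    (h0 : ∀ x, R ≤ ‖x‖ → h x = 0) :
    Integrable fun x => h x * segmentMean f x := by
  simpa only [segmentMean, integral_const_mul] using
    (integrable_prod_mul_dilation hR hC hf hfm hm hb h0).integral_prod_left

/-- Duality between averaging along segments from the origin and along rays to infinity. -/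
lemma integral_mul_segmentMean (hR : 0 ≤ R) (hC : 0 ≤ C) (hf : Integrable f)
    (hfm : Measurable f) (hm : Measurable h) (hb : ∀ x, |h x| ≤ C * ‖x‖)
    (h0 : ∀ x, R ≤ ‖x‖ → h x = 0) :
    ∫ x, h x * segmentMean f x = ∫ y, f y * ∫ s in Ioi (1 : ℝ), h (s • y) / s := by
  calc ∫ x, h x * segmentMean f x
      = ∫ x, ∫ s in Ioi (1 : ℝ), h x * ((s ^ (N + 1))⁻¹ * f (s⁻¹ • x)) := by
        simp only [segmentMean, integral_const_mul]
    _ = ∫ s in Ioi (1 : ℝ), ∫ x, h x * ((s ^ (N + 1))⁻¹ * f (s⁻¹ • x)) :=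
        integral_integral_swap (integrable_prod_mul_dilation hR hC hf hfm hm hb h0)
    _ = ∫ s in Ioi (1 : ℝ), ∫ y, f y * (h (s • y) / s) := by
        refine setIntegral_congr_fun measurableSet_Ioi fun s hs1 => ?_
        have hs0 : 0 < s := zero_lt_one.trans hs1
        have h1 := Measure.integral_comp_smul_of_nonneg (volume : Measure (Euc N))
          (fun x => h x * ((s ^ (N + 1))⁻¹ * f (s⁻¹ • x))) s (hR := hs0.le)
        simp only [mul_inv_pow_smul_eq hs0, integral_const_mul] at h1
        rw [finrank_euclideanSpace_fin, smul_eq_mul] at h1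
        exact (mul_left_cancel₀ (by positivity) h1).symm
    _ = ∫ y, ∫ s in Ioi (1 : ℝ), f y * (h (s • y) / s) :=
        (integral_integral_swap (integrable_prod_mul_comp_smul hR hC hf hfm hm hb h0)).symm
    _ = _ := by simp only [integral_const_mul]

/-- The vector field `-segmentMean f x • x` has distributional divergence `-f`. -/
lemma integral_segmentMean_mul_inner_gradient (hN : 0 < N) (hR : 0 ≤ R) (hf : Integrable f)
    (hfm : Measurable f) {φ : Euc N → ℝ} (hφ : ContDiff ℝ 1 φ) (hφc : HasCompactSupport φ)
    (hφs : tsupport φ ⊆ Metric.ball 0 R) :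
    ∫ x, ⟪-(segmentMean f x • x), ∇ φ x⟫_ℝ = ∫ x, f x * φ x := by
  have hcont : Continuous (fderiv ℝ φ) := hφ.continuous_fderiv one_ne_zero
  obtain ⟨C, hC⟩ := hcont.bounded_above_of_compact_support (hφc.fderiv ℝ)
  have hC0 : 0 ≤ C := (norm_nonneg _).trans (hC 0)
  have hdiff := hφ.differentiable one_ne_zero
  have hzero : ∀ x, R ≤ ‖x‖ → fderiv ℝ φ x = 0 := by
    intro x hx
    by_contra hne
    have := hφs (support_fderiv_subset ℝ hne)
    rw [mem_ball_zero_iff] at this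
    linarith
  have h1 : ∀ x, ⟪-(segmentMean f x • x), ∇ φ x⟫_ℝ = -(fderiv ℝ φ x x * segmentMean f x) := by
    intro x
    rw [inner_neg_left, real_inner_smul_left, real_inner_comm, gradient,
      InnerProductSpace.toDual_symm_apply, mul_comm]
  simp only [h1, integral_neg]
  have hb : ∀ x, |fderiv ℝ φ x x| ≤ C * ‖x‖ := fun x =>
    ((fderiv ℝ φ x).le_opNorm x).trans (by gcongr; exact hC x)
  have h0 : ∀ x, R ≤ ‖x‖ → fderiv ℝ φ x x = 0 := fun x hx => by simp [hzero x hx]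
  have hm : Measurable fun x => fderiv ℝ φ x x :=
    (hcont.clm_apply continuous_id).measurable
  rw [integral_mul_segmentMean hR hC0 hf hfm hm hb h0, ← integral_neg]
  have : Nonempty (Fin N) := ⟨⟨0, hN⟩⟩
  have hne : ∀ᵐ y : Euc N, y ≠ 0 := by simp [ae_iff]
  refine integral_congr_ae ?_
  filter_upwards [hne] with y hy
  -- With `h(x) = ⟨∇φ(x), x⟩`, the integrand `h(sy)/s` is `d/ds φ(sy)`, whose integral over `(1, ∞)`
  -- is `-φ(y)`.
  have hder : ∀ s : ℝ, HasDerivAt (fun s : ℝ => φ (s • y)) (fderiv ℝ φ (s • y) y) s := by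
    intro s
    have h2 : HasDerivAt (fun s : ℝ => s • y) y s := by
      simpa using (hasDerivAt_id s).smul_const y
    exact (hdiff (s • y)).hasFDerivAt.comp_hasDerivAt s h2
  have hcs : HasCompactSupport fun s : ℝ => φ (s • y) := by
    refine HasCompactSupport.intro (isCompact_Icc (a := -(R / ‖y‖)) (b := R / ‖y‖)) fun s hs => ?_
    by_contra hne
    have := hφs (subset_tsupport _ hne)
    rw [mem_ball_zero_iff, norm_smul, ← lt_div_iff₀ (norm_pos_iff.2 hy), Real.norm_eq_abs,
      abs_lt] at this
    exact hs ⟨this.1.le, this.2.le⟩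
  have hcd : ContDiff ℝ 1 fun s : ℝ => φ (s • y) :=
    hφ.comp (contDiff_id.smul contDiff_const)
  have h3 := hcs.integral_Ioi_deriv_eq hcd 1
  have h4 : ∫ s in Ioi (1 : ℝ), fderiv ℝ φ (s • y) (s • y) / s = -φ y := by
    rw [one_smul] at h3
    rw [← h3]
    refine setIntegral_congr_fun measurableSet_Ioi fun s hs1 => ?_
    have hs0 : s ≠ 0 := (zero_lt_one.trans hs1).ne'
    rw [(hder s).deriv, map_smul, smul_eq_mul, mul_div_cancel_left₀ _ hs0]
  rw [h4]
  ring

end Dilation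

/-- The segment average of a radial function in terms of its integral over balls. -/
lemma segmentMean_radial {N : ℕ} (hN : 0 < N) {G : ℝ → ℝ} {x : Euc N} (hx : x ≠ 0) :
    ∫ y in Metric.ball (0 : Euc N) ‖x‖, G ‖y‖ =
      N * (unitBallVolume N * ‖x‖ ^ N) * segmentMean (fun y => G ‖y‖) x := by
  have : Nonempty (Fin N) := ⟨⟨0, hN⟩⟩
  have hr := norm_pos_iff.2 hx
  set r := ‖x‖ with hrdef
  have h1 : ∫ y in Metric.ball (0 : Euc N) r, G ‖y‖ = ∫ y : Euc N, (Iio r).indicator G ‖y‖ := by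
    rw [← integral_indicator measurableSet_ball]
    refine integral_congr_ae (Eventually.of_forall fun y => ?_)
    by_cases h : ‖y‖ < r <;> simp [indicator, h]
  rw [h1, integral_fun_norm_addHaar, finrank_euclideanSpace_fin]
  have h2 : ∫ y in Ioi (0 : ℝ), y ^ (N - 1) • (Iio r).indicator G y
      = r ^ N * segmentMean (fun y => G ‖y‖) x := by
    rw [segmentMean]
    -- The substitution `ρ = r/s`, made as a dilation by `r` followed by the inversion `t = s⁻¹`,
    -- maps `ρ < r` to `s > 1`.
    have h3 := integral_comp_mul_left_Ioi (fun y => y ^ (N - 1) • (Iio r).indicator G y) 0 hr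
    rw [mul_zero] at h3
    have h4 := integral_comp_rpow_Ioi
      (fun t => (r * t) ^ (N - 1) • (Iio r).indicator G (r * t)) (p := -1) (by norm_num)
    rw [h3] at h4
    rw [smul_eq_mul, eq_inv_mul_iff_mul_eq₀ hr.ne'] at h4
    rw [← h4, ← integral_const_mul, ← integral_const_mul,
      ← integral_indicator measurableSet_Ioi, ← integral_indicator measurableSet_Ioi]
    refine integral_congr_ae (Eventually.of_forall fun s => ?_)
    by_cases hs0 : 0 < s
    swap
    · have : ¬ 1 < s := fun h => hs0 (zero_lt_one.trans h)
      simp [indicator, hs0, this]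
    have e1 : s ^ (-1 : ℝ) = s⁻¹ := Real.rpow_neg_one s
    have e2 : s ^ (-1 - 1 : ℝ) = (s ^ 2)⁻¹ := by
      rw [show (-1 - 1 : ℝ) = -((2 : ℕ) : ℝ) by norm_num, Real.rpow_neg hs0.le,
        Real.rpow_natCast]
    by_cases hs : 1 < s
    · have hlt : r * s⁻¹ < r := by
        rw [mul_inv_lt_iff₀ hs0]; nlinarith
      simp only [indicator, mem_Ioi, hs0, hs, if_true, e1, e2, mem_Iio, hlt, smul_eq_mul, norm_smul,
        Real.norm_eq_abs, abs_of_pos (inv_pos.2 hs0), ← hrdef]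
      obtain ⟨n, rfl⟩ : ∃ n, N = n + 1 := ⟨N - 1, by omega⟩
      rw [mul_comm s⁻¹ r]
      simp only [Nat.add_sub_cancel, abs_neg, abs_one]
      generalize G (r * s⁻¹) = c
      rw [mul_pow, inv_pow]
      field_simp
      ring
    · have hlt : ¬ r * s⁻¹ < r := by
        rw [mul_inv_lt_iff₀ hs0]; push Not at hs ⊢; nlinarith
      simp [indicator, hs0, hs, e1, hlt]
  rw [h2, nsmul_eq_mul, unitBallVolume, Measure.real, smul_eq_mul]
  ring


/-! ### Conditional expectation as radial averaging -/

/-- A function orthogonal to all test functions of `T` has zero conditional expectation given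
`T`. -/
lemma condExp_comap_eq_zero {α : Type*} {mα : MeasurableSpace α} {μ : Measure α}
    [IsFiniteMeasure μ] {T : α → ℝ} (hT : Measurable T) {U : Set ℝ} (hU : IsOpen U)
    (hTU : ∀ᵐ x ∂μ, T x ∈ U) {F : α → ℝ} (hF : Integrable F μ)
    (h : ∀ η : ℝ → ℝ, ContDiff ℝ (⊤ : ℕ∞) η → HasCompactSupport η → tsupport η ⊆ U →
      ∫ x, η (T x) * F x ∂μ = 0) :
    μ[F | MeasurableSpace.comap T inferInstance] =ᵐ[μ] 0 := by
  have hm : MeasurableSpace.comap T inferInstance ≤ mα := hT.comap_le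
  -- By Doob–Dynkin the conditional expectation is `k ∘ T`, so the fundamental lemma of the calculus
  -- of variations can be applied to `k` on the line.
  obtain ⟨k, hk, hkE⟩ := (stronglyMeasurable_condExp (f := F) (μ := μ)
    (m := MeasurableSpace.comap T inferInstance)).exists_eq_measurable_comp
  have hki : Integrable k (μ.map T) := by
    rw [integrable_map_measure hk.aestronglyMeasurable hT.aemeasurable, ← hkE]
    exact integrable_condExp
  have hk0 : ∀ᵐ t ∂(μ.map T), t ∈ U → k t = 0 := by
    refine hU.ae_eq_zero_of_integral_contDiff_smul_eq_zero
      (hki.locallyIntegrable.locallyIntegrableOn U) fun η hη hηc hηU => ?_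
    have hηm : Measurable η := hη.continuous.measurable
    obtain ⟨C, hC⟩ := hη.continuous.bounded_above_of_compact_support hηc
    have hi : Integrable (fun x => η (T x) * F x) μ :=
      hF.bdd_mul (hηm.comp hT).aestronglyMeasurable (Eventually.of_forall fun x => hC _)
    have h1 : StronglyMeasurable[MeasurableSpace.comap T inferInstance] fun x => η (T x) :=
      (hηm.comp (comap_measurable T)).stronglyMeasurable
    have h2 := condExp_mul_of_stronglyMeasurable_left h1 hi hF
    have h3 : ∫ x, η (T x) * F x ∂μ = ∫ x, η (T x) * k (T x) ∂μ := by
      refine (integral_condExp hm).symm.trans (integral_congr_ae (h2.trans ?_))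
      rw [hkE]
      rfl
    rw [integral_map hT.aemeasurable (by fun_prop), ← h η hη hηc hηU, h3]
    rfl
  rw [hkE]
  filter_upwards [ae_of_ae_map hT.aemeasurable hk0, hTU] with x hx hxU
  simp [hx hxU]

/-- A function with zero conditional expectation given `T` is orthogonal to functions of `T`. -/
lemma integral_comp_mul_eq_zero {α : Type*} {mα : MeasurableSpace α} {μ : Measure α}
    [IsFiniteMeasure μ] {T : α → ℝ} (hT : Measurable T) {F : α → ℝ} (hF : Integrable F μ)
    (h : μ[F | MeasurableSpace.comap T inferInstance] =ᵐ[μ] 0)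
    {ψ : ℝ → ℝ} (hψ : Measurable ψ) (hψF : Integrable (fun x => ψ (T x) * F x) μ) :
    ∫ x, ψ (T x) * F x ∂μ = 0 := by
  have h1 : StronglyMeasurable[MeasurableSpace.comap T inferInstance] fun x => ψ (T x) :=
    (hψ.comp (comap_measurable T)).stronglyMeasurable
  rw [← integral_condExp hT.comap_le]
  refine integral_eq_zero_of_ae ((condExp_mul_of_stronglyMeasurable_left h1 hψF hF).trans ?_)
  filter_upwards [h] with x hx
  simp [hx]

/-- Every test function of `|x|²` gives the radial derivative of a radial test function. -/
lemma exists_radial_testFunction {N : ℕ} {R : ℝ} (hR : 0 < R) {η : ℝ → ℝ}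
    (hη : ContDiff ℝ (⊤ : ℕ∞) η) (hηc : HasCompactSupport η) (hηR : tsupport η ⊆ Iio (R ^ 2)) :
    ∃ φ : 𝓓(openBall N R, ℝ), ∀ x, ∇ (φ : Euc N → ℝ) x = (2 * η (‖x‖ ^ 2)) • x := by
  obtain ⟨β, hβ0, hβR, hβ⟩ : ∃ β, 0 ≤ β ∧ β < R ^ 2 ∧ ∀ t, β ≤ t → η t = 0 := by
    rcases (tsupport η).eq_empty_or_nonempty with h | h
    · exact ⟨0, le_rfl, by positivity, fun t _ => image_eq_zero_of_notMem_tsupport (by simp [h])⟩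
    · obtain ⟨b, hb, hb'⟩ := hηc.exists_isGreatest h
      have hbR : b < R ^ 2 := hηR hb
      refine ⟨max ((b + R ^ 2) / 2) 0, le_max_right _ _, max_lt (by linarith) (by positivity),
        fun t ht => image_eq_zero_of_notMem_tsupport fun h => ?_⟩
      have := hb' h
      have := (le_max_left _ _).trans ht
      linarith
  -- Basing the primitive at `R²` makes it vanish beyond `β`, hence near the sphere. Using `|x|²`
  -- keeps `Φ(|x|²)` smooth at the origin with no condition on `η` near `0`.
  set Φ : ℝ → ℝ := fun t => ∫ s in (R ^ 2)..t, η s with hΦ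
  have hder : ∀ t, HasDerivAt Φ (η t) t := fun t =>
    (hη.continuous.integral_hasStrictDerivAt (R ^ 2) t).hasDerivAt
  have hΦc : ContDiff ℝ (⊤ : ℕ∞) Φ := by
    rw [contDiff_infty_iff_deriv]
    refine ⟨fun t => (hder t).differentiableAt, ?_⟩
    rwa [show deriv Φ = η from funext fun t => (hder t).deriv]
  have hΦ0 : ∀ t, β ≤ t → Φ t = 0 := by
    intro t ht
    rw [hΦ]
    refine (intervalIntegral.integral_congr (g := fun _ => 0) fun s hs => hβ s ?_).trans (by simp)
    exact (le_min hβR.le ht).trans hs.1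
  set φ : Euc N → ℝ := fun x => Φ (‖x‖ ^ 2) with hφ
  have hsupp : Function.support φ ⊆ Metric.closedBall 0 (√β) := by
    intro x hx
    rw [mem_closedBall_zero_iff]
    by_contra! h
    exact hx (hΦ0 _ (Real.lt_sq_of_sqrt_lt h).le)
  have hts : tsupport φ ⊆ Metric.closedBall 0 (√β) :=
    closure_minimal hsupp Metric.isClosed_closedBall
  have hβ' : √β < R := (Real.sqrt_lt' hR).2 hβR
  refine ⟨⟨φ, hΦc.comp (contDiff_norm_sq ℝ),
    (isCompact_closedBall _ _).of_isClosed_subset (isClosed_tsupport _) hts,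
    hts.trans (Metric.closedBall_subset_ball hβ')⟩, fun x => ?_⟩
  refine HasGradientAt.gradient ?_
  rw [hasGradientAt_iff_hasFDerivAt]
  have h1 := (hder (‖x‖ ^ 2)).comp_hasFDerivAt x (hasStrictFDerivAt_norm_sq x).hasFDerivAt
  convert! h1 using 1
  ext y
  simp [InnerProductSpace.toDual_apply_apply]
  ring

/-! ### Monotonicity of `H_α` and its degeneracy -/

section Monotone

variable {N : ℕ} {α : ℝ}

lemma posPart_eq_of_rpow_eq (hα : 0 < α) {s t : ℝ} :
    (max (s - 1) 0) ^ α = (max (t - 1) 0) ^ α → max (s - 1) 0 = max (t - 1) 0 := fun h =>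
  (Real.rpow_left_inj (le_max_right _ _) (le_max_right _ _) hα.ne').1 h

lemma mul_sub_posPart_rpow_nonneg (hα : 0 < α) (s t : ℝ) :
    0 ≤ ((max (s - 1) 0) ^ α - (max (t - 1) 0) ^ α) * (s - t) := by
  rcases le_total s t with h | h
  · have : (max (s - 1) 0) ^ α ≤ (max (t - 1) 0) ^ α := by gcongr
    nlinarith
  · have : (max (t - 1) 0) ^ α ≤ (max (s - 1) 0) ^ α := by gcongr
    nlinarith

lemma norm_inv_smul_le_one (ξ : Euc N) : ‖‖ξ‖⁻¹ • ξ‖ ≤ 1 := by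
  rcases eq_or_ne ξ 0 with rfl | h
  · simp
  · rw [norm_smul, norm_inv, norm_norm, inv_mul_cancel₀ (norm_ne_zero_iff.2 h)]

/-- Polar coordinates separate the discrepancy in length from that in direction. Both terms are
non-negative, so each vanishes when the sum does. -/
lemma inner_H_sub_H_eq (ξ ζ : Euc N) :
    ⟪H α ξ - H α ζ, ξ - ζ⟫_ℝ =
      ((max (‖ξ‖ - 1) 0) ^ α - (max (‖ζ‖ - 1) 0) ^ α) * (‖ξ‖ - ‖ζ‖) +
      (1 - ⟪‖ξ‖⁻¹ • ξ, ‖ζ‖⁻¹ • ζ⟫_ℝ) *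
        ((max (‖ξ‖ - 1) 0) ^ α * ‖ζ‖ + (max (‖ζ‖ - 1) 0) ^ α * ‖ξ‖) := by
  have key : ∀ v : Euc N, ‖v‖ • (‖v‖⁻¹ • v) = v := by
    intro v
    rcases eq_or_ne v 0 with rfl | h
    · simp
    · rw [smul_smul, mul_inv_cancel₀ (norm_ne_zero_iff.2 h), one_smul]
  have key2 : ∀ v : Euc N, ⟪‖v‖⁻¹ • v, v⟫_ℝ = ‖v‖ := by
    intro v
    rcases eq_or_ne v 0 with rfl | h
    · simp
    · rw [real_inner_smul_left, real_inner_self_eq_norm_sq, sq,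
        inv_mul_cancel_left₀ (norm_ne_zero_iff.2 h)]
  have h1 : ⟪‖ξ‖⁻¹ • ξ, ζ⟫_ℝ = ‖ζ‖ * ⟪‖ξ‖⁻¹ • ξ, ‖ζ‖⁻¹ • ζ⟫_ℝ := by
    rw [← real_inner_smul_right, key]
  have h2 : ⟪‖ζ‖⁻¹ • ζ, ξ⟫_ℝ = ‖ξ‖ * ⟪‖ξ‖⁻¹ • ξ, ‖ζ‖⁻¹ • ζ⟫_ℝ := by
    rw [← real_inner_smul_left, key, real_inner_comm]
  unfold H
  rw [inner_sub_left, inner_sub_right, inner_sub_right]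
  simp only [real_inner_smul_left _ _ ((max (_ - 1) 0) ^ α), key2, h1, h2]
  ring

lemma inner_normalized_le_one (ξ ζ : Euc N) : ⟪‖ξ‖⁻¹ • ξ, ‖ζ‖⁻¹ • ζ⟫_ℝ ≤ 1 :=
  (real_inner_le_norm _ _).trans
    (mul_le_one₀ (norm_inv_smul_le_one ξ) (norm_nonneg _) (norm_inv_smul_le_one ζ))

lemma inner_H_sub_H_nonneg (hα : 0 < α) (ξ ζ : Euc N) : 0 ≤ ⟪H α ξ - H α ζ, ξ - ζ⟫_ℝ := by
  rw [inner_H_sub_H_eq]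
  have := inner_normalized_le_one ξ ζ
  exact add_nonneg (mul_sub_posPart_rpow_nonneg hα _ _)
    (mul_nonneg (by linarith) (by positivity))

/-- Strict monotonicity of `H α`, up to the degeneracy in the unit ball. -/
lemma H_one_eq_of_inner_eq_zero (hα : 0 < α) {ξ ζ : Euc N}
    (h : ⟪H α ξ - H α ζ, ξ - ζ⟫_ℝ = 0) : H 1 ξ = H 1 ζ := by
  rw [inner_H_sub_H_eq] at h
  have hc := inner_normalized_le_one ξ ζ
  have h1 := mul_sub_posPart_rpow_nonneg hα ‖ξ‖ ‖ζ‖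
  have h2 : 0 ≤ (1 - ⟪‖ξ‖⁻¹ • ξ, ‖ζ‖⁻¹ • ζ⟫_ℝ) *
        ((max (‖ξ‖ - 1) 0) ^ α * ‖ζ‖ + (max (‖ζ‖ - 1) 0) ^ α * ‖ξ‖) :=
    mul_nonneg (by linarith) (by positivity)
  obtain ⟨h3, h4⟩ := (add_eq_zero_iff_of_nonneg h1 h2).1 h
  have h5 : max (‖ξ‖ - 1) 0 = max (‖ζ‖ - 1) 0 := by
    rcases mul_eq_zero.1 h3 with h | h
    · exact posPart_eq_of_rpow_eq hα (sub_eq_zero.1 h)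
    · rw [sub_eq_zero.1 h]
  unfold H
  rw [h5]
  rcases (le_max_right (‖ζ‖ - 1) 0).eq_or_lt with h0 | h0
  · simp [← h0]
  · have hζ : 1 < ‖ζ‖ := by
      by_contra! h
      rw [max_eq_right (by linarith)] at h0
      exact lt_irrefl _ h0
    have hξ : 1 < ‖ξ‖ := by
      by_contra! h
      rw [← h5, max_eq_right (by linarith)] at h0
      exact lt_irrefl _ h0
    -- Outside the unit ball the weight of the angular term is positive, so the two directions must
    -- coincide.
    have hne : (max (‖ξ‖ - 1) 0) ^ α * ‖ζ‖ + (max (‖ζ‖ - 1) 0) ^ α * ‖ξ‖ ≠ 0 := by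
      rw [h5]
      have := Real.rpow_pos_of_pos h0 α
      positivity
    have h6 : ⟪‖ξ‖⁻¹ • ξ, ‖ζ‖⁻¹ • ζ⟫_ℝ = 1 := by
      have := (mul_eq_zero.1 h4).resolve_right hne
      linarith
    have hn : ∀ v : Euc N, 1 < ‖v‖ → ‖‖v‖⁻¹ • v‖ = 1 := fun v hv => by
      rw [norm_smul, norm_inv, norm_norm, inv_mul_cancel₀ (by linarith)]
    rw [(inner_eq_one_iff_of_norm_eq_one (hn ξ hξ) (hn ζ hζ)).1 h6]

lemma norm_H (α : ℝ) (hα : 0 < α) (ξ : Euc N) : ‖H α ξ‖ = (max (‖ξ‖ - 1) 0) ^ α := by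
  unfold H
  rw [norm_smul, Real.norm_of_nonneg (by positivity)]
  rcases eq_or_ne ξ 0 with rfl | h
  · simp [hα.ne']
  · rw [norm_smul, norm_inv, norm_norm, inv_mul_cancel₀ (norm_ne_zero_iff.2 h), mul_one]

lemma measurable_H (α : ℝ) : Measurable (H α : Euc N → Euc N) := by
  unfold H
  fun_prop

/-- `H α` on vectors of norm at least one. -/
lemma H_add_one_smul {a : ℝ} (ha : 0 ≤ a) {e : Euc N} (he : ‖e‖ = 1) :
    H α ((1 + a) • e) = a ^ α • e := by
  unfold H
  have : ‖(1 + a) • e‖ = 1 + a := by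
    rw [norm_smul, he, mul_one, Real.norm_of_nonneg (by positivity)]
  rw [this, smul_smul _ _ e, inv_mul_cancel₀ (by positivity), one_smul, add_sub_cancel_left,
    max_eq_left ha]

/-- Vectors of norm larger than one are determined by `H 1`. -/
lemma eq_of_H_one_eq {a : ℝ} (ha : 0 ≤ a) {e ξ : Euc N} (he : ‖e‖ = 1) (hξ : 1 < ‖ξ‖)
    (h : H 1 ξ = a • e) : ξ = (1 + a) • e := by
  have hn := norm_H 1 one_pos ξ
  rw [h, norm_smul, he, mul_one, Real.norm_of_nonneg ha, Real.rpow_one,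
    max_eq_left (by linarith)] at hn
  unfold H at h
  rw [Real.rpow_one, max_eq_left (by linarith), ← hn] at h
  have h2 := smul_right_injective _ (show a ≠ 0 by linarith) h
  rw [← h2, smul_smul, show 1 + a = ‖ξ‖ by linarith, mul_inv_cancel₀ (by linarith), one_smul]

end Monotone


/-! ### Pairing with the solution and comparison of fluxes -/

section WeakSolution

variable {N : ℕ} {R p : ℝ}

lemma isFiniteMeasure_ballMeasure : IsFiniteMeasure (ballMeasure N R) := by
  unfold ballMeasure
  exact ⟨by simpa using measure_ball_lt_top⟩

lemma continuous_gradient_testFunction (φ : 𝓓(openBall N R, ℝ)) :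
    Continuous (∇ (φ : Euc N → ℝ)) :=
  (InnerProductSpace.toDual ℝ (Euc N)).symm.continuous.comp
    (φ.contDiff.continuous_fderiv (by simp))

lemma exists_bound_gradient_testFunction (φ : 𝓓(openBall N R, ℝ)) :
    ∃ C, ∀ x, ‖∇ (φ : Euc N → ℝ) x‖ ≤ C := by
  obtain ⟨C, hC⟩ := (φ.contDiff.continuous_fderiv (by simp)).bounded_above_of_compact_support
    (φ.hasCompactSupport.fderiv ℝ)
  exact ⟨C, fun x => by simpa [gradient] using hC x⟩

lemma integrable_inner_gradient {X : Euc N → Euc N} (hX : Integrable X (ballMeasure N R))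
    (φ : 𝓓(openBall N R, ℝ)) :
    Integrable (fun x => ⟪X x, ∇ (φ : Euc N → ℝ) x⟫_ℝ) (ballMeasure N R) := by
  obtain ⟨C, hC⟩ := exists_bound_gradient_testFunction φ
  refine Integrable.mono' (hX.norm.mul_const C)
    (hX.1.inner (continuous_gradient_testFunction φ).aestronglyMeasurable)
    (Eventually.of_forall fun x => ?_)
  exact (norm_inner_le_norm _ _).trans (by gcongr; exact hC x)

section Duality

variable {α : Type*} [MeasurableSpace α] {μ : Measure α}

lemma integrable_inner_of_memLp {p q : ℝ≥0∞} [ENNReal.HolderTriple q p 1] {X Y : α → Euc N} (hX : MemLp X q μ)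
    (hY : MemLp Y p μ) : Integrable (fun x => ⟪X x, Y x⟫_ℝ) μ := by
  rw [← memLp_one_iff_integrable]
  refine MemLp.of_bilin (fun a b => ⟪a, b⟫_ℝ) 1 hX hY (hX.1.inner hY.1) ?_
  exact Eventually.of_forall fun x => by
    simpa using nnnorm_inner_le_nnnorm (𝕜 := ℝ) (X x) (Y x)

lemma tendsto_integral_inner {p q : ℝ≥0∞} [ENNReal.HolderTriple q p 1] {X Y : α → Euc N}
    {Z : ℕ → α → Euc N} (hX : MemLp X q μ) (hY : MemLp Y p μ)
    (hZ : ∀ n, AEStronglyMeasurable (Z n) μ)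
    (hi : ∀ n, Integrable (fun x => ⟪X x, Z n x⟫_ℝ) μ)
    (h : Tendsto (fun n => eLpNorm (fun x => Z n x - Y x) p μ) atTop (𝓝 0)) :
    Tendsto (fun n => ∫ x, ⟪X x, Z n x⟫_ℝ ∂μ) atTop (𝓝 (∫ x, ⟪X x, Y x⟫_ℝ ∂μ)) := by
  refine tendsto_integral_of_L1' _ (hX.1.inner hY.1) (Eventually.of_forall hi) ?_
  have h1 : Tendsto (fun n => eLpNorm X q μ * eLpNorm (fun x => Z n x - Y x) p μ) atTop
      (𝓝 0) := by
    simpa using ENNReal.Tendsto.const_mul h (Or.inr hX.2.ne)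
  refine tendsto_of_tendsto_of_tendsto_of_le_of_le tendsto_const_nhds h1 (fun _ => zero_le)
    fun n => ?_
  have h2 := eLpNorm_le_eLpNorm_mul_eLpNorm_of_nnnorm (p := q) (q := p) (r := 1) hX.1
    ((hZ n).sub hY.1) (fun a b => ⟪a, b⟫_ℝ) 1
    (Eventually.of_forall fun x => by
      simpa using nnnorm_inner_le_nnnorm (𝕜 := ℝ) (X x) ((Z n - Y) x))
  simp only [ENNReal.coe_one, one_mul, Pi.sub_apply, inner_sub_right] at h2
  exact h2

end Duality

/-- Follows from `|H_{p-1}(ξ)| ≤ |ξ|^{p-1}` and `p/(p-1) = q`. -/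
lemma memLp_H {q : ℝ} (hp : 1 < p) (hpq : q.HolderConjugate p) {μ : Measure (Euc N)}
    {X : Euc N → Euc N} (hX : MemLp X (ENNReal.ofReal p) μ) :
    MemLp (fun x => H (p - 1) (X x)) (ENNReal.ofReal q) μ := by
  have h1 := hX.norm_rpow_div (ENNReal.ofReal (p - 1))
  rw [ENNReal.toReal_ofReal (by linarith), ← ENNReal.ofReal_div_of_pos (by linarith),
    ← (Real.holderConjugate_iff_eq_conjExponent hp).1 hpq.symm] at h1
  refine h1.of_le ((measurable_H _).comp_aemeasurable hX.1.aemeasurable).aestronglyMeasurable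
    (Eventually.of_forall fun x => ?_)
  rw [norm_H _ (by linarith), Real.norm_of_nonneg (by positivity)]
  exact Real.rpow_le_rpow (le_max_right _ _) (max_le (by linarith) (norm_nonneg _)) (by linarith)

/-- A `W₀^{1,p}` solution of `div (H (∇u)) = div (-a x/|x|)` with radial `a ≥ 0` satisfies
`H₁(∇u) = -a^{1/(p-1)} x/|x|`. -/
lemma H_one_eq_of_radial_flux (hN : 0 < N) (hR : 0 < R) (hp : 1 < p) {a : Euc N → ℝ} {b : ℝ → ℝ}
    (hb : Measurable b) (hab : ∀ x, a x = b (‖x‖ ^ 2)) (ha0 : ∀ x, 0 ≤ a x)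
    (hai : Integrable a (ballMeasure N R)) {u : Euc N → ℝ} {Du : Euc N → Euc N}
    (hu : MemW01p (openBall N R) (ENNReal.ofReal p) u Du)
    (hdiv : ∀ φ : 𝓓(openBall N R, ℝ),
      ∫ x in Metric.ball 0 R, ⟪H (p - 1) (Du x), ∇ (φ : Euc N → ℝ) x⟫_ℝ =
        ∫ x in Metric.ball 0 R, ⟪-(a x • (‖x‖⁻¹ • x)), ∇ (φ : Euc N → ℝ) x⟫_ℝ) :
    ∀ᵐ x ∂(ballMeasure N R), H 1 (Du x) = -(a x ^ (1 / (p - 1)) • (‖x‖⁻¹ • x)) := by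
  set μ := ballMeasure N R with hμ
  have hfin : IsFiniteMeasure μ := isFiniteMeasure_ballMeasure
  set ν : Euc N → Euc N := fun x => ‖x‖⁻¹ • x with hν
  have hνm : Measurable ν := by fun_prop
  have hν1 : ∀ x, ‖ν x‖ ≤ 1 := norm_inv_smul_le_one
  have ham : Measurable a := by
    rw [show a = fun x => b (‖x‖ ^ 2) from funext hab]; fun_prop
  obtain ⟨q, hpq⟩ : ∃ q : ℝ, q.HolderConjugate p :=
    ⟨_, (Real.HolderConjugate.conjExponent hp).symm⟩
  have hpq' : ENNReal.HolderConjugate (ENNReal.ofReal q) (ENNReal.ofReal p) :=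
    hpq.ennrealOfReal
  have htriple : ENNReal.HolderTriple (ENNReal.ofReal q) (ENNReal.ofReal p) 1 := hpq'
  have hp1 : 0 < p - 1 := by linarith
  have hq1 : 1 ≤ ENNReal.ofReal q := by
    rw [← ENNReal.ofReal_one]; exact ENNReal.ofReal_le_ofReal hpq.lt.le
  have hDu : MemLp Du (ENNReal.ofReal p) μ := hu.memW1p.memLp_grad
  set A : Euc N → Euc N := fun x => H (p - 1) (Du x) with hA
  have hAq : MemLp A (ENNReal.ofReal q) μ := memLp_H hp hpq hDu
  have hAi : Integrable A μ := hAq.integrable hq1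
  have hVi : Integrable (fun x => a x • ν x) μ :=
    hai.mono (ham.smul hνm).aestronglyMeasurable (Eventually.of_forall fun x => by
      rw [norm_smul]; exact mul_le_of_le_one_right (norm_nonneg _) (hν1 x))
  set D : Euc N → Euc N := fun x => A x + a x • ν x with hD
  have hDi : Integrable D μ := hAi.add hVi
  have hDφ : ∀ φ : 𝓓(openBall N R, ℝ), ∫ x, ⟪D x, ∇ (φ : Euc N → ℝ) x⟫_ℝ ∂μ = 0 := by
    intro φ
    simp only [hD, inner_add_left]
    rw [integral_add (integrable_inner_gradient hAi φ) (integrable_inner_gradient hVi φ)]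
    have := hdiv φ
    simp only [inner_neg_left, integral_neg] at this
    exact add_eq_zero_iff_eq_neg.2 this
  -- radial averages of `D` vanish
  set T : Euc N → ℝ := fun x => ‖x‖ ^ 2 with hTdef
  have hT : Measurable T := by fun_prop
  have hball := ae_ballMeasure_mem hN R
  have hE1 : μ[fun x => ⟪D x, x⟫_ℝ | MeasurableSpace.comap T inferInstance] =ᵐ[μ] 0 := by
    refine condExp_comap_eq_zero hT (U := Iio (R ^ 2)) isOpen_Iio ?_ ?_ ?_
    · filter_upwards [hball] with x hx
      exact pow_lt_pow_left₀ hx.2 (norm_nonneg _) two_ne_zero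
    · refine (hDi.norm.mul_const R).mono' (hDi.1.inner aestronglyMeasurable_id) ?_
      filter_upwards [hball] with x hx
      exact (norm_inner_le_norm _ _).trans (by gcongr; exact hx.2.le)
    · intro η hη hηc hηR
      obtain ⟨φ, hφ⟩ := exists_radial_testFunction (N := N) hR hη hηc hηR
      have h1 := hDφ φ
      simp only [hφ, real_inner_smul_right, mul_assoc, integral_const_mul] at h1
      simpa using h1
  set F : Euc N → ℝ := fun x => ⟪D x, ν x⟫_ℝ with hF
  have hFi : Integrable F μ := hDi.norm.mono' (hDi.1.inner hνm.aestronglyMeasurable)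
    (Eventually.of_forall fun x => (norm_inner_le_norm _ _).trans
      (mul_le_of_le_one_right (norm_nonneg _) (hν1 x)))
  have hTm : Measurable[MeasurableSpace.comap T inferInstance] T := comap_measurable T
  have hE2 : μ[F | MeasurableSpace.comap T inferInstance] =ᵐ[μ] 0 := by
    -- The factor `1/|x|` is a function of `T`, so it pulls out of the conditional expectation.
    have h1 : F = (fun x => (√(T x))⁻¹) * fun x => ⟪D x, x⟫_ℝ := by
      ext x
      simp [hF, hν, hTdef, real_inner_smul_right]
    have h2 : StronglyMeasurable[MeasurableSpace.comap T inferInstance] fun x => (√(T x))⁻¹ :=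
      (Measurable.inv (Real.continuous_sqrt.measurable.comp hTm)).stronglyMeasurable
    have h3 : Integrable (fun x => ⟪D x, x⟫_ℝ) μ := by
      refine (hDi.norm.mul_const R).mono' (hDi.1.inner aestronglyMeasurable_id) ?_
      filter_upwards [hball] with x hx
      exact (norm_inner_le_norm _ _).trans (by gcongr; exact hx.2.le)
    have h4 := condExp_mul_of_stronglyMeasurable_left h2 (h1 ▸ hFi) h3
    rw [← h1] at h4
    filter_upwards [h4, hE1] with x hx hx'
    simp [hx, hx']
  -- hence the flux `a` inherits the integrability of `A`
  have haq : MemLp a (ENNReal.ofReal q) μ := by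
    have hwq : MemLp (fun x => ⟪A x, ν x⟫_ℝ) (ENNReal.ofReal q) μ :=
      hAq.of_le (hAq.1.inner hνm.aestronglyMeasurable)
        (Eventually.of_forall fun x => (norm_inner_le_norm _ _).trans
          (mul_le_of_le_one_right (norm_nonneg _) (hν1 x)))
    have h1 : F =ᵐ[μ] (fun x => ⟪A x, ν x⟫_ℝ) + a := by
      filter_upwards [hball] with x hx
      have hn : ‖ν x‖ = 1 := by
        rw [hν, norm_smul, norm_inv, norm_norm, inv_mul_cancel₀ hx.1.ne']
      simp [hF, hD, inner_add_left, real_inner_smul_left, hn]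
    have h2 : μ[a | MeasurableSpace.comap T inferInstance] = a := condExp_of_stronglyMeasurable hT.comap_le
      (by rw [show a = b ∘ T from funext hab]; exact (hb.comp hTm).stronglyMeasurable) hai
    have h3 := (condExp_congr_ae (m := MeasurableSpace.comap T inferInstance) h1).symm.trans hE2
    have h4 := (condExp_add (hwq.integrable hq1) hai
      (MeasurableSpace.comap T inferInstance)).symm.trans h3
    -- Since `a` is its own conditional expectation, `h4` says that `-a` is that of `⟨A, ν⟩`, which
    -- stays in `L^q`.
    refine (hwq.condExp (m := MeasurableSpace.comap T inferInstance) hq1).of_le ham.aestronglyMeasurable ?_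
    filter_upwards [h4] with x hx
    rw [h2, Pi.add_apply, Pi.zero_apply] at hx
    rw [show a x = -(μ[fun x => ⟪A x, ν x⟫_ℝ | MeasurableSpace.comap T inferInstance]) x by linarith, norm_neg]
  have hDq : MemLp D (ENNReal.ofReal q) μ := by
    refine hAq.add (haq.of_le (ham.smul hνm).aestronglyMeasurable
      (Eventually.of_forall fun x => ?_))
    rw [norm_smul]
    exact mul_le_of_le_one_right (norm_nonneg _) (hν1 x)
  -- The zero boundary condition enters here: `Du` is an `L^p` limit of test gradients, and `D ∈
  -- L^q`.
  have hD1 : ∫ x, ⟪D x, Du x⟫_ℝ ∂μ = 0 := by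
    obtain ⟨φ, -, hφ⟩ := hu.approx
    have h1 := tendsto_integral_inner hDq hDu
      (fun n => (continuous_gradient_testFunction (φ n)).aestronglyMeasurable)
      (fun n => integrable_inner_gradient hDi (φ n)) hφ
    simp only [hDφ] at h1
    exact tendsto_nhds_unique h1 tendsto_const_nhds
  -- the radial comparison field
  set c : Euc N → ℝ := fun x => a x ^ (1 / (p - 1)) with hc
  have hc0 : ∀ x, 0 ≤ c x := fun x => Real.rpow_nonneg (ha0 x) _
  have hcm : Measurable c := ham.pow_const _
  have hcp : MemLp c (ENNReal.ofReal p) μ := by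
    have h1 := haq.norm_rpow_div (ENNReal.ofReal (1 / (p - 1)))
    rw [ENNReal.toReal_ofReal (by positivity), ← ENNReal.ofReal_div_of_pos (by positivity),
      (Real.holderConjugate_iff_eq_conjExponent hp).1 hpq.symm] at h1
    rw [show p / (p - 1) / (1 / (p - 1)) = p by field_simp] at h1
    exact h1.congr_norm hcm.aestronglyMeasurable
      (Eventually.of_forall fun x => by rw [Real.norm_of_nonneg (ha0 x)])
  set W : Euc N → Euc N := fun x => (1 + c x) • -ν x with hW
  have hWp : MemLp W (ENNReal.ofReal p) μ := by
    refine ((memLp_const (1 : ℝ)).add hcp).of_le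
      ((measurable_const.add hcm).smul hνm.neg).aestronglyMeasurable
      (Eventually.of_forall fun x => ?_)
    rw [hW, norm_smul, norm_neg]
    exact mul_le_of_le_one_right (norm_nonneg _) (hν1 x)
  -- The integrand is a function of `T` times `F`, so the vanishing radial average suffices.
  have hD2 : ∫ x, ⟪D x, W x⟫_ℝ ∂μ = 0 := by
    have h1 : ∀ x, ⟪D x, W x⟫_ℝ = -(1 + b (T x) ^ (1 / (p - 1))) * F x := by
      intro x
      simp only [hW, hF, hc, hab, hTdef, real_inner_smul_right, inner_neg_right]
      ring
    have h2 := integrable_inner_of_memLp hDq hWp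
    simp only [h1] at h2 ⊢
    exact integral_comp_mul_eq_zero (ψ := fun t => -(1 + b t ^ (1 / (p - 1)))) hT hFi hE2
      (by fun_prop) h2
  have hDW : ∀ᵐ x ∂μ, D x = H (p - 1) (Du x) - H (p - 1) (W x) ∧ ‖ν x‖ = 1 := by
    filter_upwards [hball] with x hx
    have hn : ‖ν x‖ = 1 := by
      rw [hν, norm_smul, norm_inv, norm_norm, inv_mul_cancel₀ hx.1.ne']
    refine ⟨?_, hn⟩
    rw [hW, H_add_one_smul (hc0 x) (by rwa [norm_neg]), hc, ← Real.rpow_mul (ha0 x),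
      one_div_mul_cancel hp1.ne', Real.rpow_one, smul_neg, sub_neg_eq_add]
  have hzero : ∫ x, ⟪D x, (Du - W) x⟫_ℝ ∂μ = 0 := by
    simp only [Pi.sub_apply, inner_sub_right]
    rw [integral_sub (integrable_inner_of_memLp hDq hDu) (integrable_inner_of_memLp hDq hWp), hD1, hD2, sub_zero]
  rw [integral_eq_zero_iff_of_nonneg_ae _ (integrable_inner_of_memLp hDq (hDu.sub hWp))] at hzero
  · filter_upwards [hzero, hDW] with x hx hx'
    rw [hx'.1] at hx
    have := H_one_eq_of_inner_eq_zero hp1 hx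
    rw [this, hW, H_add_one_smul (hc0 x) (by rw [norm_neg, hx'.2]), Real.rpow_one, smul_neg]
  · filter_upwards [hDW] with x hx
    rw [hx.1]
    exact inner_H_sub_H_nonneg hp1 _ _


end WeakSolution

/-! ### Identification of the profile and conclusion -/

lemma measurable_indicator_of_antitoneOn {s : Set ℝ} (hs : MeasurableSet s) {g : ℝ → ℝ}
    (hg : AntitoneOn g s) : Measurable (s.indicator g) := by
  refine measurable_of_restrict_of_restrict_compl hs ?_ ?_
  · have h1 : Antitone (s.domRestrict (s.indicator g)) := by
      intro x y hxy
      simpa [indicator_of_mem x.2, indicator_of_mem y.2] using hg x.2 y.2 hxy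
    exact h1.measurable
  · have : sᶜ.domRestrict (s.indicator g) = fun _ => 0 := by
      ext x
      simpa using indicator_of_notMem x.2 g
    rw [this]
    exact measurable_const

/-- The radial profile of a radially decreasing function is an average along segments. -/
lemma profile_eq_segmentMean {N : ℕ} (hN : 0 < N) {R p : ℝ} {f : Euc N → ℝ} {g G : ℝ → ℝ}
    (hf : AEMeasurable f (ballMeasure N R)) (hg : AntitoneOn g (Ioo 0 R)) (hg0 : ∀ s, 0 ≤ g s)
    (hfg : ∀ᵐ x ∂(ballMeasure N R), f x = g ‖x‖)
    (hfG : ∀ᵐ x ∂(ballMeasure N R), f x = G ‖x‖) {x : Euc N} (hx : 0 < ‖x‖) (hxR : ‖x‖ < R) :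
    profile p R f x = (‖x‖ * segmentMean (fun y => G ‖y‖) x) ^ (1 / (p - 1)) := by
  have hC : 0 < unitBallVolume N :=
    ENNReal.toReal_pos (Metric.measure_ball_pos _ _ one_pos).ne' measure_ball_lt_top.ne
  have hle : volume.restrict (Metric.ball 0 ‖x‖) ≤ ballMeasure N R :=
    Measure.restrict_mono (Metric.ball_subset_ball hxR.le) le_rfl
  unfold profile maxRearr
  rw [lintegral_decRearr_of_radial hN hx.le hxR.le hf hg hg0 hfg, ENNReal.toReal_div,
    ENNReal.toReal_ofReal (by positivity),
    ← integral_norm_eq_lintegral_enorm (hf.mono_measure hle).aestronglyMeasurable]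
  have h1 : ∫ y in Metric.ball (0 : Euc N) ‖x‖, ‖f y‖ =
      ∫ y in Metric.ball (0 : Euc N) ‖x‖, G ‖y‖ := by
    refine integral_congr_ae ?_
    filter_upwards [ae_mono hle hfg, ae_mono hle hfG] with y h1 h2
    rw [Real.norm_of_nonneg (by rw [h1]; exact hg0 _), h2]
  rw [h1, segmentMean_radial hN (norm_pos_iff.1 hx)]
  congr 1
  have : (N : ℝ) ≠ 0 := by positivity
  field_simp

end WidelyDegenerate

theorem theorem1 (N : ℕ) (hN : 2 ≤ N) (R : ℝ) (hR : 0 < R)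
    (f : WidelyDegenerate.Euc N → ℝ)
    (hf : IntegrableOn f (Metric.ball 0 R) volume)
    (hf_nonneg : ∀ᵐ x ∂(WidelyDegenerate.ballMeasure N R), 0 ≤ f x)
    (hf_radial : WidelyDegenerate.RadiallyDecreasing R f)
    (p : ℝ) (hp : 1 < p)
    (u : WidelyDegenerate.Euc N → ℝ) (Du : WidelyDegenerate.Euc N → WidelyDegenerate.Euc N)
    (hu : WidelyDegenerate.IsWeakSolution p R f u Du) :
    (∀ᵐ x ∂(WidelyDegenerate.ballMeasure N R),
      WidelyDegenerate.H 1 (Du x) =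
        -(WidelyDegenerate.profile p R f x • (‖x‖⁻¹ • x))) ∧
    (∀ᵐ x ∂(WidelyDegenerate.ballMeasure N R), 1 < ‖Du x‖ →
      Du x = -((1 + WidelyDegenerate.profile p R f x) • (‖x‖⁻¹ • x))) := by
  open WidelyDegenerate in
  have hN0 : 0 < N := by omega
  have hball := ae_ballMeasure_mem hN0 R
  obtain ⟨g₀, hg₀, hfg₀⟩ := hf_radial
  -- The positive part remains antitone and still represents `f`, but is non-negative everywhere;
  -- cutting it off to `(0, R)` below makes it Borel and extends `f` by zero.
  set g : ℝ → ℝ := fun s => max (g₀ s) 0 with hgdef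
  have hg : AntitoneOn g (Ioo 0 R) := fun s hs t ht hst =>
    max_le_max (hg₀ hs ht hst) le_rfl
  have hg0 : ∀ s, 0 ≤ g s := fun s => le_max_right _ _
  have hfg : ∀ᵐ x ∂(ballMeasure N R), f x = g ‖x‖ := by
    filter_upwards [hfg₀, hf_nonneg] with x h1 h2
    rw [hgdef]
    simp only
    rw [← h1, max_eq_left h2]
  set G : ℝ → ℝ := (Ioo 0 R).indicator g with hG
  have hGm : Measurable G := measurable_indicator_of_antitoneOn measurableSet_Ioo hg
  have hG0 : ∀ s, 0 ≤ G s := fun s => indicator_nonneg (fun _ _ => hg0 _) _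
  have hfG : ∀ᵐ x ∂(ballMeasure N R), f x = G ‖x‖ := by
    filter_upwards [hfg, hball] with x h1 h2
    rw [h1, hG, indicator_of_mem (show ‖x‖ ∈ Ioo 0 R from h2)]
  set F : Euc N → ℝ := fun y => G ‖y‖ with hF
  have hFm : Measurable F := hGm.comp measurable_norm
  have hF0 : ∀ x, x ∉ Metric.ball (0 : Euc N) R → F x = 0 := by
    intro x hx
    refine indicator_of_notMem (fun h => hx (mem_ball_zero_iff.2 h.2)) _
  have hFi : Integrable F :=
    (integrableOn_iff_integrable_of_support_subset fun x hx => by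
      by_contra h; exact hx (hF0 x h)).1 (hf.congr hfG)
  set a : Euc N → ℝ := fun x => ‖x‖ * segmentMean F x with ha
  have ha0 : ∀ x, 0 ≤ a x := fun x => mul_nonneg (norm_nonneg _) <|
    setIntegral_nonneg measurableSet_Ioi fun s hs =>
      mul_nonneg (inv_nonneg.2 (pow_nonneg (zero_le_one.trans hs.le) _)) (hG0 _)
  set b : ℝ → ℝ := fun t => √t * ∫ s in Ioi (1 : ℝ), (s ^ (N + 1))⁻¹ * G (s⁻¹ * √t) with hb
  have hbm : Measurable b := by
    have h1 : StronglyMeasurable fun t : ℝ =>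
        ∫ s in Ioi (1 : ℝ), (s ^ (N + 1))⁻¹ * G (s⁻¹ * √t) :=
      StronglyMeasurable.integral_prod_right
        (f := fun t s : ℝ => (s ^ (N + 1))⁻¹ * G (s⁻¹ * √t))
        (Measurable.stronglyMeasurable (by fun_prop))
    exact Real.continuous_sqrt.measurable.mul h1.measurable
  have hab : ∀ x, a x = b (‖x‖ ^ 2) := by
    intro x
    simp only [ha, hb, Real.sqrt_sq (norm_nonneg x), segmentMean]
    congr 1
    refine setIntegral_congr_fun measurableSet_Ioi fun s hs => ?_
    have hs0 : 0 ≤ s := zero_le_one.trans (le_of_lt hs)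
    simp only [hF, norm_smul, norm_inv, Real.norm_of_nonneg hs0]
  have hai : Integrable a (ballMeasure N R) := by
    -- On the ball `a` is the segment mean times the weight `h = |x|`, truncated to the ball.
    have h1 := integrable_mul_segmentMean (R := R) (C := 1)
      (h := (Metric.ball (0 : Euc N) R).indicator fun x => ‖x‖) hR.le zero_le_one hFi hFm
      (measurable_norm.indicator measurableSet_ball)
      (fun x => by
        rw [one_mul, abs_of_nonneg (indicator_nonneg (fun _ _ => norm_nonneg _) _)]
        exact indicator_le_self' (fun _ _ => norm_nonneg _) x)
      (fun x hx => indicator_of_notMem (by simpa using hx) _)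
    refine (h1.mono_measure (Measure.restrict_le_self (s := Metric.ball 0 R))).congr ?_
    filter_upwards [ae_restrict_mem measurableSet_ball] with x hx
    rw [indicator_of_mem hx]
  have hprof : ∀ᵐ x ∂(ballMeasure N R), profile p R f x = a x ^ (1 / (p - 1)) := by
    filter_upwards [hball] with x hx
    exact profile_eq_segmentMean hN0 hf.aemeasurable hg hg0 hfg hfG hx.1 hx.2
  have hH : ∀ᵐ x ∂(ballMeasure N R),
      H 1 (Du x) = -(a x ^ (1 / (p - 1)) • (‖x‖⁻¹ • x)) := by
    refine H_one_eq_of_radial_flux hN0 hR hp hbm hab ha0 hai hu.memW01p fun φ => ?_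
    have hφ : ∀ x, a x • (‖x‖⁻¹ • x) = segmentMean F x • x := by
      intro x
      rcases eq_or_ne x 0 with rfl | hx
      · simp
      · rw [ha, smul_smul, mul_right_comm, mul_inv_cancel₀ (norm_ne_zero_iff.2 hx), one_mul]
    have h1 := integral_segmentMean_mul_inner_gradient hN0 hR.le hFi hFm
      (φ.contDiff.of_le (by simp)) φ.hasCompactSupport φ.tsupport_subset
    have h2 : ∫ x in Metric.ball 0 R, f x * φ x = ∫ x, F x * φ x := by
      have h3 : ∀ x, x ∉ Metric.ball (0 : Euc N) R → F x * φ x = 0 := fun x hx => by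
        rw [hF0 x hx, zero_mul]
      rw [← setIntegral_eq_integral_of_forall_compl_eq_zero h3]
      refine integral_congr_ae ?_
      filter_upwards [hfG] with x hx
      rw [hx]
    rw [hu.integral_eq φ, h2, ← h1]
    simp only [hφ]
    refine (setIntegral_eq_integral_of_forall_compl_eq_zero fun x hx => ?_).symm
    have : fderiv ℝ φ x = 0 := by
      by_contra hne
      exact hx (φ.tsupport_subset (support_fderiv_subset ℝ hne))
    rw [gradient, this, map_zero, inner_zero_right]
  refine ⟨?_, ?_⟩
  · filter_upwards [hH, hprof] with x h1 h2
    rw [h1, h2]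
  · filter_upwards [hH, hprof, hball] with x h1 h2 h3 h4
    rw [h2, ← smul_neg]
    -- The sign is absorbed into the unit vector `-x/|x|`, leaving a non-negative coefficient.
    rw [← smul_neg] at h1
    refine eq_of_H_one_eq (Real.rpow_nonneg (ha0 x) _) ?_ h4 h1
    rw [norm_neg, norm_smul, norm_inv, norm_norm, inv_mul_cancel₀ h3.1.ne']
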